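/- Let $G$ be a finite group of exponent $m$, let $S\subseteq G$ be conjugate-closed (i.e. $g^{-1}sg\in S$ for all $s\in S$, $g\in G$), and let $\Gamma=\mathrm{BCay}(G,S)$ be the undirected graph whose vertex set is the disjoint union of two copies $G_1=\{g_1\mid g\in G\}$ and $G_2=\{g_2\mid g\in G\}$ of $G$ and whose edges are the pairs $\{g_1,(sg)_2\}$ with $g\in G$, $s\in S$. The splitting field $\mathrm{SF}(\Gamma)\subseteq\mathbb{C}$ is the field generated over $\mathbb{Q}$ by all eigenvalues of the adjacency matrix of $\Gamma$, and $\deg(\Gamma)=[\mathrm{SF}(\Gamma):\mathbb{Q}]$. Let $\omega_m\in\mathbb{C}$ be a primitive $m$-th root of unity, and let $\eta:\mathrm{Gal}(\mathbb{Q}(\omega_m)/\mathbb{Q})\to\mathbb{Z}_m^*=(\mathbb{Z}/m\mathbb{Z})^{\times}$ send $\sigma$ to the $t$ with $\sigma(\omega_m)=\omega_m^t$. For a multiset $X$ of elements of $G$ write $X^t=[x^t\mid x\in X]$, and let $SS^{-1}=[xy^{-1}\mid x,y\in S]$, both as multisets (counted with multiplicity). Put $$T=\{t\in\mathbb{Z}_m^*\mid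 (SS^{-1})^t=SS^{-1}\},\qquad K=\{x\in\mathbb{Q}(\omega_m)\mid \sigma(x)=x\ \text{for all}\ \sigma\in\eta^{-1}(T)\}.$$ Let $\mathrm{Irr}(G)$ be the set of irreducible complex characters of $G$, and write $\chi(S)=\sum_{s\in S}\chi(s)$. Then $|\chi(S)|^2\in K$ for every $\chi\in\mathrm{Irr}(G)$; the splitting field of $\Gamma$ is $$\mathrm{SF}(\Gamma)=K\bigl(|\chi(S)|\ \big|\ \chi\in\mathrm{Irr}(G)\bigr),$$ which is a finite extension of $\mathbb{Q}$; and $$\deg(\Gamma)=\frac{\varphi(m)\,|M|}{|T|},$$ where $\varphi$ is Euler's function and $M$ is the subgroup of $K^{\times}/(K^{\times})^2$ generated by the classes $[|\chi(S)|^2]_K$ for those $\chi\in\mathrm{Irr}(G)$ with $\chi(S)\neq 0$. -/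

import Mathlib

open scoped IntermediateField

noncomputable section

/-- A subset `S` of a group is conjugate-closed if `g⁻¹ s g ∈ S` for all `s ∈ S` and all `g`. -/
def ConjugateClosed {G : Type*} [Group G] (S : Finset G) : Prop :=
  ∀ s ∈ S, ∀ g : G, g⁻¹ * s * g ∈ S

/-- The bi-Cayley graph `BCay(G, S)`: the vertex set is the disjoint union of two copies
`G₁ = {inl g}` and `G₂ = {inr g}` of `G`, and the edges are the pairs `{g₁, (s g)₂}`
with `g ∈ G` and `s ∈ S`. -/
def BCay {G : Type*} [Group G] (S : Finset G) : SimpleGraph (G ⊕ G) where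
  Adj x y :=
    (∃ g : G, ∃ s ∈ S, x = Sum.inl g ∧ y = Sum.inr (s * g)) ∨
      (∃ g : G, ∃ s ∈ S, y = Sum.inl g ∧ x = Sum.inr (s * g))
  symm := ⟨fun _ _ h => h.symm⟩
  loopless := ⟨by
    rintro x (⟨g, s, _, h₁, h₂⟩ | ⟨g, s, _, h₁, h₂⟩) <;> exact Sum.inl_ne_inr (h₁.symm.trans h₂)⟩

open Classical in
/-- The splitting field of a finite graph: the subfield of `ℂ` generated over `ℚ` by all complex
roots of the characteristic polynomial of the adjacency matrix. -/
def graphSplittingField {V : Type*} [Fintype V] (Γ : SimpleGraph V) : IntermediateField ℚ ℂ :=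
  IntermediateField.adjoin ℚ {z : ℂ | (Γ.adjMatrix ℂ).charpoly.IsRoot z}

/-- The algebraic degree of a finite graph: the degree over `ℚ` of its splitting field. -/
def algebraicDegree {V : Type*} [Fintype V] (Γ : SimpleGraph V) : ℕ :=
  Module.finrank ℚ (graphSplittingField Γ)

/-- The set of irreducible complex characters of `G`. Every finite-dimensional complex
representation is equivalent to one on some `ℂⁿ`. -/
def Irr (G : Type*) [Group G] : Set (G → ℂ) :=
  {χ | ∃ (n : ℕ) (ρ : Representation ℂ G (Fin n → ℂ)), ρ.IsIrreducible ∧ ρ.character = χ}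

/-- `χ(A) = ∑_{a ∈ A} χ(a)`, counted with multiplicity. -/
def charSum {G : Type*} (χ : G → ℂ) (A : Multiset G) : ℂ := (A.map χ).sum

/-- The multiset `S S⁻¹ = [x y⁻¹ | x ∈ S, y ∈ S]`, with multiplicities. -/
def mulInvMultiset {G : Type*} [Group G] (S : Finset G) : Multiset G :=
  (S.val ×ˢ S.val).map fun p => p.1 * p.2⁻¹

/-- The multiset `X^z = [x^z | x ∈ X]`, with multiplicities. -/
def multisetPow {G : Type*} [Group G] (X : Multiset G) (z : ℕ) : Multiset G :=
  X.map fun x => x ^ z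

theorem multisetPow_mul_units {G : Type*} [Group G] (X : Multiset G)
    (s t : (ZMod (Monoid.exponent G))ˣ) :
    multisetPow X ((s * t : (ZMod (Monoid.exponent G))ˣ) : ZMod (Monoid.exponent G)).val =
      multisetPow (multisetPow X (s : ZMod (Monoid.exponent G)).val)
        (t : ZMod (Monoid.exponent G)).val := by
  simp only [multisetPow, Multiset.map_map, Function.comp_def, ← pow_mul]
  refine Multiset.map_congr rfl fun x _ => ?_
  rw [Units.val_mul, ZMod.val_mul]
  exact (pow_eq_pow_mod _ (Monoid.pow_exponent_eq_one x)).symm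

theorem multisetPow_one_units {G : Type*} [Group G] (X : Multiset G) :
    multisetPow X ((1 : (ZMod (Monoid.exponent G))ˣ) : ZMod (Monoid.exponent G)).val = X := by
  have h : ∀ x : G, x ^ ((1 : (ZMod (Monoid.exponent G))ˣ) : ZMod (Monoid.exponent G)).val = x := by
    intro x
    rw [Units.val_one, ZMod.val_one_eq_one_mod,
      ← pow_eq_pow_mod _ (Monoid.pow_exponent_eq_one x), pow_one]
  exact (Multiset.map_congr rfl fun x _ => h x).trans (Multiset.map_id' X)

/-- For a multiset `X` of elements of a group of exponent `m`, the subgroup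
`{t ∈ (ℤ/mℤ)ˣ | X^t = X}` of `(ℤ/mℤ)ˣ`. -/
def powStabilizer {G : Type*} [Group G] (X : Multiset G) :
    Subgroup (ZMod (Monoid.exponent G))ˣ where
  carrier := {t | multisetPow X (t : ZMod (Monoid.exponent G)).val = X}
  one_mem' := multisetPow_one_units X
  mul_mem' := by
    intro s t hs ht
    change multisetPow X _ = X at hs ht ⊢
    rw [multisetPow_mul_units, hs, ht]
  inv_mem' := by
    intro t ht
    change multisetPow X _ = X at ht ⊢
    have h := multisetPow_mul_units X t t⁻¹
    rw [ht, mul_inv_cancel, multisetPow_one_units] at h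
    exact h.symm

theorem isPrimitiveRoot_gen {m : ℕ} {ω : ℂ} (hω : IsPrimitiveRoot ω m) :
    IsPrimitiveRoot (IntermediateField.AdjoinSimple.gen ℚ ω) m :=
  IsPrimitiveRoot.of_map_of_injective (f := algebraMap ℚ⟮ω⟯ ℂ)
    (by rw [IntermediateField.AdjoinSimple.algebraMap_gen]; exact hω)
    (algebraMap ℚ⟮ω⟯ ℂ).injective

/-- The homomorphism `η : Gal(ℚ(ω)/ℚ) → (ℤ/mℤ)ˣ`, `σ ↦ t` with `σ(ω) = ω ^ t`, where `ω` is a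
primitive `m`-th root of unity. -/
def cyclotomicEta {m : ℕ} [NeZero m] {ω : ℂ} (hω : IsPrimitiveRoot ω m) :
    (ℚ⟮ω⟯ ≃ₐ[ℚ] ℚ⟮ω⟯) →* (ZMod m)ˣ :=
  (isPrimitiveRoot_gen hω).autToPow ℚ

/-- The field `{x ∈ ℚ(ω) | σ x = x for all σ ∈ η⁻¹(T)}`, as a subfield of `ℂ`. -/
def fixedSubfield {m : ℕ} [NeZero m] {ω : ℂ} (hω : IsPrimitiveRoot ω m)
    (T : Subgroup (ZMod m)ˣ) : IntermediateField ℚ ℂ :=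
  IntermediateField.lift (IntermediateField.fixedField (T.comap (cyclotomicEta hω)))

/-- The subgroup of `Kˣ / (Kˣ)²` generated by the classes `[a]_K` of the nonzero elements
`a ∈ K` that lie in `A`. -/
def squareClassSubgroup (K : IntermediateField ℚ ℂ) (A : Set ℂ) :
    Subgroup (Kˣ ⧸ (powMonoidHom 2 : Kˣ →* Kˣ).range) :=
  Subgroup.closure {c | ∃ u : Kˣ, ((u : K) : ℂ) ∈ A ∧ c = QuotientGroup.mk u}

end

/-!
The adjacency matrix of `BCay(G, S)` is block off-diagonal, and its blocks are the matrices of left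
multiplication by `∑ s` and `∑ s⁻¹` on `ℂ[G]`. Hence `z` is an eigenvalue if and only if `z ^ 2` is
in the spectrum of the central element `∑_{x ∈ SS⁻¹} x`, on which the irreducible representation
with character `χ` acts by the scalar `|χ(S)|² / χ(1)²`. Since `χ(1)` is rational, `SF(Γ)` is
generated over `ℚ` by the numbers `|χ(S)|`.

An automorphism `σ` with `η(σ) = t` sends `χ(SS⁻¹) = |χ(S)|² / χ(1)` to `χ((SS⁻¹)^t)`. Characters
separate conjugation invariant multisets, so `σ` fixes all of these values if and only if `t ∈ T`.
By Galois theory `K` is generated by the `|χ(S)|²` and has degree `φ(m) / |T|`. Thus `SF(Γ)` is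
obtained from `K` by adjoining square roots of elements of `K`, and Kummer theory gives its degree
over `K` as `|M|`.
-/

section LinearAlgebra

open Polynomial

theorem trace_pow_eq_sum_of_basis {ι R M : Type*} [CommRing R] [AddCommGroup M] [Module R M]
    [Fintype ι] (b : Module.Basis ι R M) {f : Module.End R M} {μ : ι → R}
    (hf : ∀ i, f (b i) = μ i • b i) (k : ℕ) :
    LinearMap.trace R M (f ^ k) = ∑ i, μ i ^ k := by
  classical
  have hpow (i : ι) : (f ^ k) (b i) = μ i ^ k • b i := by
    induction k with
    | zero => simp
    | succ k ih => rw [pow_succ', Module.End.mul_apply, ih, map_smul, hf, smul_smul, pow_succ]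
  simp [LinearMap.trace_eq_matrix_trace R b, Matrix.trace, LinearMap.toMatrix_apply, hpow]

theorem exists_basis_apply_eq_smul {K V : Type*} [Field K] [IsAlgClosed K] [AddCommGroup V]
    [Module K V] [FiniteDimensional K V] {f : Module.End K V} (hf : f.IsSemisimple) :
    ∃ (b : Module.Basis (Fin (Module.finrank K V)) K V) (μ : Fin (Module.finrank K V) → K),
      ∀ i, f (b i) = μ i • b i := by
  classical
  have hinternal : DirectSum.IsInternal f.eigenspace :=
    DirectSum.isInternal_submodule_of_iSupIndep_of_iSup_eq_top f.eigenspaces_iSupIndep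
      hf.iSup_eigenspace_eq_top
  let b := hinternal.collectedBasis fun μ => Module.finBasis K (f.eigenspace μ)
  have : Fintype (Σ μ, Fin (Module.finrank K (f.eigenspace μ))) :=
    FiniteDimensional.fintypeBasisIndex b
  let e := Fintype.equivFinOfCardEq (Module.finrank_eq_card_basis b).symm
  refine ⟨b.reindex e, fun i => (e.symm i).1, fun i => ?_⟩
  rw [b.reindex_apply]
  exact Module.End.mem_eigenspace_iff.1 (hinternal.collectedBasis_mem _ _)

theorem isSemisimple_of_pow_eq_one {K V : Type*} [Field K] [AddCommGroup V] [Module K V] {m : ℕ}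
    (hm : (m : K) ≠ 0) {f : Module.End K V} (hf : f ^ m = 1) : f.IsSemisimple :=
  Module.End.isSemisimple_of_squarefree_aeval_eq_zero
    (X_pow_sub_one_separable_iff.2 hm).squarefree (by simp [hf])

theorem exists_trace_pow_eq_sum_pow {K V : Type*} [Field K] [IsAlgClosed K] [AddCommGroup V]
    [Module K V] [FiniteDimensional K V] {m : ℕ} (hm : (m : K) ≠ 0) {f : Module.End K V}
    (hf : f ^ m = 1) :
    ∃ μ : Fin (Module.finrank K V) → K,
      (∀ i, μ i ^ m = 1) ∧ ∀ k, LinearMap.trace K V (f ^ k) = ∑ i, μ i ^ k := by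
  obtain ⟨b, μ, hμ⟩ := exists_basis_apply_eq_smul (isSemisimple_of_pow_eq_one hm hf)
  have hpow (i) : (f ^ m) (b i) = μ i ^ m • b i :=
    (Module.End.HasEigenvector.pow_apply ⟨Module.End.mem_eigenspace_iff.2 (hμ i), b.ne_zero i⟩ m)
  refine ⟨μ, fun i => smul_left_injective K (b.ne_zero i) ?_, trace_pow_eq_sum_of_basis b hμ⟩
  simpa [hf] using (hpow i).symm

theorem charpoly_fromBlocks_zero_zero {m n R : Type*} [Fintype m] [DecidableEq m] [Fintype n]
    [DecidableEq n] [CommRing R] (A : Matrix m n R) (B : Matrix n m R) :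
    X ^ Fintype.card n * (Matrix.fromBlocks 0 A B 0).charpoly =
      X ^ Fintype.card m * expand R 2 (B * A).charpoly := by
  have hexpand : expand R 2 (B * A).charpoly =
      (Matrix.scalar n (X ^ 2 : R[X]) - (B * A).map C).det := by
    rw [Matrix.charpoly, AlgHom.map_det, Matrix.charmatrix]
    congr 1
    ext i j : 1
    by_cases h : i = j <;> simp [h, -Matrix.map_mul]
  -- Column operations clear the upper right block of the characteristic matrix.
  have hmul : (Matrix.fromBlocks 0 A B 0).charmatrix *
      Matrix.fromBlocks 1 (A.map C) 0 (Matrix.scalar n X) =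
      Matrix.fromBlocks (Matrix.scalar m X) 0 (-B.map C)
        (Matrix.scalar n (X ^ 2 : R[X]) - (B * A).map C) := by
    rw [Matrix.charmatrix_fromBlocks, Matrix.fromBlocks_multiply, Matrix.map_mul]
    congr 1
    · simp [Matrix.charmatrix]
    · rw [Matrix.charmatrix, map_zero, sub_zero, Matrix.neg_mul,
        Matrix.scalar_comm _ (Commute.all _), add_neg_cancel]
    · simp
    · simp [Matrix.charmatrix, sub_eq_add_neg, sq, add_comm]
  have hdet := congrArg Matrix.det hmul
  rwa [Matrix.det_mul, Matrix.det_fromBlocks_zero₂₁, Matrix.det_fromBlocks_zero₁₂, Matrix.det_one,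
    one_mul, ← hexpand, Matrix.scalar_apply, Matrix.scalar_apply, Matrix.det_diagonal,
    Matrix.det_diagonal, Finset.prod_const, Finset.prod_const, Finset.card_univ, Finset.card_univ,
    mul_comm] at hdet

theorem isRoot_charpoly_fromBlocks_zero_zero_iff {n R : Type*} [Fintype n] [DecidableEq n]
    [CommRing R] (A B : Matrix n n R) (z : R) :
    (Matrix.fromBlocks 0 A B 0).charpoly.IsRoot z ↔ (B * A).charpoly.IsRoot (z ^ 2) := by
  have h : (Matrix.fromBlocks 0 A B 0).charpoly = expand R 2 (B * A).charpoly :=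
    (isRegular_X_pow _).left.eq_iff.1 (charpoly_fromBlocks_zero_zero A B)
  rw [h, IsRoot.def, expand_eval, IsRoot.def]

theorem isRoot_charpoly_leftMulMatrix_iff {n F A : Type*} [Fintype n] [DecidableEq n] [Field F]
    [Ring A] [Algebra F A] (b : Module.Basis n F A) (a : A) (z : F) :
    (Algebra.leftMulMatrix b a).charpoly.IsRoot z ↔ z ∈ spectrum F a := by
  have : Module.Finite F A := .of_basis b
  have : Module.Free F A := .of_basis b
  rw [Algebra.leftMulMatrix_apply, LinearMap.charpoly_toMatrix,
    ← Module.End.mem_spectrum_iff_isRoot_charpoly, spectrum.mem_iff, spectrum.mem_iff,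
    ← AlgHom.commutes (Algebra.lmul F A), ← map_sub, Algebra.lmul_isUnit_iff]

end LinearAlgebra

section Representations

open scoped MonoidAlgebra

theorem isUnit_iff_forall_isMaximal_notMem {R : Type*} [Ring R] {a : R} (ha : a ∈ Set.center R) :
    IsUnit a ↔ ∀ I : Ideal R, I.IsMaximal → a ∉ I := by
  refine ⟨fun hu I hI haI => hI.ne_top (I.eq_top_of_isUnit_mem haI hu), fun h => ?_⟩
  by_contra hu
  have hspan : Ideal.span {a} ≠ ⊤ := fun htop => by
    obtain ⟨b, hb⟩ := Ideal.mem_span_singleton'.1 ((Ideal.eq_top_iff_one _).1 htop)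
    exact hu ⟨⟨a, b, (ha.comm b).eq.trans hb, hb⟩, rfl⟩
  obtain ⟨I, hI, hle⟩ := Ideal.exists_le_maximal _ hspan
  exact h I hI (hle (Ideal.mem_span_singleton_self a))

theorem annihilator_quotient_le {R : Type*} [Ring R] (I : Ideal R) :
    Module.annihilator R (R ⧸ I) ≤ I := fun a ha => by
  simpa [← Submodule.Quotient.mk_smul] using
    Module.mem_annihilator.1 ha (Submodule.Quotient.mk 1)

theorem mem_annihilator_quotient_iff_of_mem_center {R : Type*} [Ring R] {I : Ideal R} {a : R}
    (ha : a ∈ Set.center R) : a ∈ Module.annihilator R (R ⧸ I) ↔ a ∈ I := by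
  refine ⟨fun h => annihilator_quotient_le I h, fun h => Module.mem_annihilator.2 fun x => ?_⟩
  obtain ⟨b, rfl⟩ := Submodule.Quotient.mk_surjective I x
  rw [← Submodule.Quotient.mk_smul, smul_eq_mul, (ha.comm b).eq, Submodule.Quotient.mk_eq_zero]
  exact I.mul_mem_left b h

variable {k G : Type*} [Field k]

theorem mem_annihilator_asModule_iff [Monoid G] {V : Type*} [AddCommGroup V] [Module k V]
    (ρ : Representation k G V) (a : k[G]) :
    a ∈ Module.annihilator k[G] ρ.asModule ↔ ρ.asAlgebraHom a = 0 := by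
  rw [Module.mem_annihilator, LinearMap.ext_iff, ρ.asModuleEquiv.surjective.forall]
  simp only [← Representation.asModuleEquiv_map_smul, LinearMap.zero_apply,
    LinearEquiv.map_eq_zero_iff]

theorem exists_asModule_linearEquiv [Monoid G] (M : Type*) [AddCommGroup M] [Module k M]
    [FiniteDimensional k M] [Module k[G] M] [IsScalarTower k k[G] M] :
    ∃ ρ : Representation k G (Fin (Module.finrank k M) → k),
      Nonempty (ρ.asModule ≃ₗ[k[G]] M) := by
  let e := (Module.finBasis k M).equivFun
  let φ : k[G] →ₐ[k] Module.End k (Fin (Module.finrank k M) → k) :=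
    (e.conjAlgEquiv k).toAlgHom.comp (Algebra.lsmul k k M)
  let ρ := (MonoidAlgebra.lift k _ G).symm φ
  have hρ : Representation.asAlgebraHom ρ = φ := (MonoidAlgebra.lift k _ G).apply_symm_apply φ
  refine ⟨ρ, ⟨{ (Representation.asModuleEquiv ρ).trans e.symm with map_smul' := fun a x => ?_ }⟩⟩
  change e.symm (Representation.asModuleEquiv ρ (a • x)) =
    a • e.symm (Representation.asModuleEquiv ρ x)
  rw [Representation.asModuleEquiv_map_smul, hρ]
  exact e.symm_apply_apply _

variable [Group G]

theorem exists_isIrreducible_annihilator_eq [Finite G] (I : Ideal k[G]) [hI : I.IsMaximal] :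
    ∃ (n : ℕ) (ρ : Representation k G (Fin n → k)), ρ.IsIrreducible ∧
      Module.annihilator k[G] ρ.asModule = Module.annihilator k[G] (k[G] ⧸ I) := by
  have : Module.Finite k k[G] := .of_basis (MonoidAlgebra.basis G k)
  have : FiniteDimensional k (k[G] ⧸ I) := .of_surjective ((Submodule.mkQ I).restrictScalars k)
    (Submodule.mkQ_surjective I)
  have : IsSimpleModule k[G] (k[G] ⧸ I) := isSimpleModule_iff_isCoatom.2 hI.1
  obtain ⟨ρ, ⟨e⟩⟩ := exists_asModule_linearEquiv (k := k) (G := G) (k[G] ⧸ I)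
  have hρ : ρ.IsIrreducible :=
    (Representation.irreducible_iff_isSimpleModule_asModule ρ).2 (IsSimpleModule.congr e)
  exact ⟨_, ρ, hρ, e.annihilator_eq⟩

theorem eq_zero_of_forall_isIrreducible_asAlgebraHom_eq_zero [Finite G] [NeZero (Nat.card G : k)]
    {a : k[G]} (h : ∀ (n : ℕ) (ρ : Representation k G (Fin n → k)), ρ.IsIrreducible →
      ρ.asAlgebraHom a = 0) : a = 0 := by
  rw [← Submodule.mem_bot k[G], ← IsSemisimpleRing.jacobson_eq_bot k[G],
    Ring.jacobson_eq_sInf_isMaximal, Submodule.mem_sInf]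
  intro I (hI : Ideal.IsMaximal I)
  obtain ⟨n, ρ, hρ, hann⟩ := exists_isIrreducible_annihilator_eq I
  exact annihilator_quotient_le I (hann ▸ (mem_annihilator_asModule_iff ρ a).2 (h n ρ hρ))

theorem nontrivial_of_isIrreducible {V : Type*} [AddCommGroup V] [Module k V]
    (ρ : Representation k G V) [ρ.IsIrreducible] : Nontrivial V :=
  ρ.asModuleEquiv.symm.toEquiv.nontrivial_congr.2 (IsSimpleModule.nontrivial k[G] ρ.asModule)

theorem mem_spectrum_iff_exists_isIrreducible [Finite G] {a : k[G]}
    (ha : a ∈ Subalgebra.center k k[G]) (z : k) :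
    z ∈ spectrum k a ↔ ∃ (n : ℕ) (ρ : Representation k G (Fin n → k)), ρ.IsIrreducible ∧
      ρ.asAlgebraHom a = z • 1 := by
  have hcentral : algebraMap k k[G] z - a ∈ Subalgebra.center k k[G] :=
    sub_mem (algebraMap_mem _ z) ha
  have hzero {n : ℕ} (ρ : Representation k G (Fin n → k)) :
      ρ.asAlgebraHom (algebraMap k k[G] z - a) = 0 ↔ ρ.asAlgebraHom a = z • 1 := by
    rw [map_sub, AlgHom.commutes, Algebra.algebraMap_eq_smul_one, sub_eq_zero, eq_comm]
  simp only [← hzero]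
  rw [spectrum.mem_iff]
  constructor
  · rw [isUnit_iff_forall_isMaximal_notMem hcentral]
    push Not
    rintro ⟨I, hI, hmem⟩
    obtain ⟨n, ρ, hρ, hann⟩ := exists_isIrreducible_annihilator_eq I
    refine ⟨n, ρ, hρ, (mem_annihilator_asModule_iff ρ _).1 ?_⟩
    rwa [hann, mem_annihilator_quotient_iff_of_mem_center hcentral]
  · rintro ⟨n, ρ, hρ, h⟩ hu
    have := nontrivial_of_isIrreducible ρ
    exact not_isUnit_zero (h ▸ hu.map ρ.asAlgebraHom)

theorem exists_asAlgebraHom_eq_smul_one [IsAlgClosed k] {V : Type*} [AddCommGroup V] [Module k V]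
    [FiniteDimensional k V] (ρ : Representation k G V) [ρ.IsIrreducible] {a : k[G]}
    (ha : a ∈ Subalgebra.center k k[G]) : ∃ c : k, ρ.asAlgebraHom a = c • 1 := by
  obtain ⟨c, hc⟩ :=
    (Representation.IsIrreducible.algebraMap_intertwiningMap_bijective_of_isAlgClosed (ρ := ρ)).2
      (Representation.IntertwiningMap.centralAlgebraMul ρ ha)
  exact ⟨c, LinearMap.ext fun v => (DFunLike.congr_fun hc v).symm⟩

theorem character_one_ne_zero [CharZero k] {V : Type*} [AddCommGroup V] [Module k V]
    [FiniteDimensional k V] (ρ : Representation k G V) [ρ.IsIrreducible] : ρ.character 1 ≠ 0 := by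
  have := nontrivial_of_isIrreducible ρ
  rw [Representation.char_one]
  exact Nat.cast_ne_zero.2 Module.finrank_pos.ne'

theorem asAlgebraHom_eq_trace_div_smul_one [IsAlgClosed k] [CharZero k] {V : Type*}
    [AddCommGroup V] [Module k V] [FiniteDimensional k V] (ρ : Representation k G V)
    [ρ.IsIrreducible] {a : k[G]} (ha : a ∈ Subalgebra.center k k[G]) :
    ρ.asAlgebraHom a = (LinearMap.trace k V (ρ.asAlgebraHom a) / ρ.character 1) • 1 := by
  obtain ⟨c, hc⟩ := exists_asAlgebraHom_eq_smul_one ρ ha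
  have htrace : LinearMap.trace k V (ρ.asAlgebraHom a) = c * ρ.character 1 := by
    rw [hc, map_smul, LinearMap.trace_one, Representation.char_one, smul_eq_mul]
  rw [htrace, mul_div_cancel_right₀ _ (character_one_ne_zero ρ), hc]

end Representations

section GroupAlgebraSums

open scoped MonoidAlgebra

theorem mem_center_monoidAlgebra_iff {k G : Type*} [CommSemiring k] [Monoid G] {a : k[G]} :
    a ∈ Subalgebra.center k k[G] ↔
      ∀ g, MonoidAlgebra.of k G g * a = a * MonoidAlgebra.of k G g := by
  rw [Subalgebra.mem_center_iff]
  refine ⟨fun h g => h _, fun h b => ?_⟩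
  induction b using MonoidAlgebra.induction_on with
  | of g => exact h g
  | add b c hb hc => rw [add_mul, mul_add, hb, hc]
  | smul r b hb => rw [smul_mul_assoc, mul_smul_comm, hb]

variable {G : Type*} [Group G] (k : Type*) [CommSemiring k]

/-- The sum in the group algebra of the elements of a multiset, counted with multiplicity. It turns
identities between multisets into identities in the algebra, where representations apply. -/
noncomputable def groupAlgebraSum (X : Multiset G) : k[G] :=
  (X.map (MonoidAlgebra.of k G)).sum

theorem coeff_groupAlgebraSum [DecidableEq G] (X : Multiset G) (g : G) :
    (groupAlgebraSum k X).coeff g = X.count g := by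
  induction X using Multiset.induction_on with
  | empty => simp [groupAlgebraSum]
  | cons x X ih =>
    rw [groupAlgebraSum, Multiset.map_cons, Multiset.sum_cons, ← groupAlgebraSum,
      MonoidAlgebra.coeff_add, Finsupp.add_apply, ih, Multiset.count_cons]
    by_cases h : g = x <;> simp [h, add_comm]

theorem groupAlgebraSum_injective [CharZero k] :
    Function.Injective (groupAlgebraSum k : Multiset G → k[G]) := by
  classical
  refine fun X Y h => Multiset.ext.2 fun g => Nat.cast_injective (R := k) ?_
  rw [← coeff_groupAlgebraSum, ← coeff_groupAlgebraSum, h]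

theorem groupAlgebraSum_map_conj (X : Multiset G) (g : G) :
    groupAlgebraSum k (X.map (MulAut.conj g)) =
      MonoidAlgebra.of k G g * groupAlgebraSum k X * MonoidAlgebra.of k G g⁻¹ := by
  simp only [groupAlgebraSum, Multiset.map_map, ← Multiset.sum_map_mul_left,
    ← Multiset.sum_map_mul_right, Function.comp_def, MulAut.conj_apply, map_mul]

theorem groupAlgebraSum_mulInvMultiset (S : Finset G) :
    groupAlgebraSum k (mulInvMultiset S) =
      groupAlgebraSum k S.val * groupAlgebraSum k (S.val.map (·⁻¹)) := by
  have hprod : groupAlgebraSum k (mulInvMultiset S) =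
      ∑ p ∈ S ×ˢ S, MonoidAlgebra.of k G (p.1 * p.2⁻¹) := by
    rw [groupAlgebraSum, mulInvMultiset, Multiset.map_map]
    rfl
  rw [hprod, groupAlgebraSum, groupAlgebraSum, Multiset.map_map, Finset.sum_product]
  simp only [map_mul]
  exact (Finset.sum_mul_sum S S _ _).symm

/-- A multiset of group elements is conjugation invariant if conjugate elements have the same
multiplicity, i.e. if conjugation by any element permutes it. -/
def ConjInvariant (X : Multiset G) : Prop :=
  ∀ g : G, X.map (MulAut.conj g) = X

theorem groupAlgebraSum_mem_center_iff [CharZero k] {X : Multiset G} :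
    groupAlgebraSum k X ∈ Subalgebra.center k k[G] ↔ ConjInvariant X := by
  rw [mem_center_monoidAlgebra_iff]
  refine forall_congr' fun g => ?_
  have hg : IsUnit (MonoidAlgebra.of k G g) := (Group.isUnit g).map _
  rw [← (groupAlgebraSum_injective k).eq_iff, groupAlgebraSum_map_conj,
    ← hg.mul_left_inj (c := groupAlgebraSum k X), mul_assoc (_ * _), ← map_mul, inv_mul_cancel,
    map_one, mul_one]

theorem ConjInvariant.map {X : Multiset G} (hX : ConjInvariant X) {f : G → G}
    (hf : ∀ g x, f (MulAut.conj g x) = MulAut.conj g (f x)) : ConjInvariant (X.map f) := fun g => by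
  conv_rhs => rw [← hX g]
  simp only [Multiset.map_map, Function.comp_def, hf]

theorem ConjInvariant.map_inv {X : Multiset G} (hX : ConjInvariant X) :
    ConjInvariant (X.map (·⁻¹)) :=
  hX.map fun g x => (_root_.map_inv (MulAut.conj g) x).symm

theorem ConjInvariant.multisetPow {X : Multiset G} (hX : ConjInvariant X) (n : ℕ) :
    ConjInvariant (multisetPow X n) :=
  hX.map fun g x => (map_pow (MulAut.conj g) x n).symm

theorem ConjugateClosed.conjInvariant {S : Finset G} (hS : ConjugateClosed S) :
    ConjInvariant S.val := fun g => by
  have hmap : S.map (MulAut.conj g).toEquiv.toEmbedding = S := by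
    refine Finset.eq_of_subset_of_card_le (fun y hy => ?_) (Finset.card_map _).ge
    obtain ⟨x, hx, rfl⟩ := Finset.mem_map.1 hy
    simpa using hS x hx g⁻¹
  exact congrArg Finset.val hmap

theorem ConjugateClosed.conjInvariant_mulInvMultiset {S : Finset G} (hS : ConjugateClosed S) :
    ConjInvariant (mulInvMultiset S) := by
  rw [← groupAlgebraSum_mem_center_iff ℂ, groupAlgebraSum_mulInvMultiset]
  exact mul_mem ((groupAlgebraSum_mem_center_iff ℂ).2 hS.conjInvariant)
    ((groupAlgebraSum_mem_center_iff ℂ).2 hS.conjInvariant.map_inv)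

end GroupAlgebraSums

section Characters

open scoped ComplexConjugate

variable {G : Type*} [Group G]

section

variable {V : Type*} [AddCommGroup V] [Module ℂ V]

theorem trace_asAlgebraHom_groupAlgebraSum (ρ : Representation ℂ G V) (X : Multiset G) :
    LinearMap.trace ℂ V (ρ.asAlgebraHom (groupAlgebraSum ℂ X)) = charSum ρ.character X := by
  rw [groupAlgebraSum, charSum, map_multiset_sum, map_multiset_sum, Multiset.map_map,
    Multiset.map_map]
  simp only [Function.comp_def, Representation.asAlgebraHom_of]
  rfl

variable [FiniteDimensional ℂ V]

theorem asAlgebraHom_groupAlgebraSum_eq_smul_one (ρ : Representation ℂ G V) [ρ.IsIrreducible]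
    {X : Multiset G} (hX : ConjInvariant X) :
    ρ.asAlgebraHom (groupAlgebraSum ℂ X) = (charSum ρ.character X / ρ.character 1) • 1 := by
  rw [← trace_asAlgebraHom_groupAlgebraSum]
  exact asAlgebraHom_eq_trace_div_smul_one ρ ((groupAlgebraSum_mem_center_iff ℂ).2 hX)

variable [Finite G] {ω : ℂ} (hω : IsPrimitiveRoot ω (Monoid.exponent G))

include hω

theorem exists_character_pow_eq_sum (ρ : Representation ℂ G V) (g : G) :
    ∃ e : Multiset ℕ, ∀ j : ℕ, ρ.character (g ^ j) = (e.map fun i => (ω ^ i) ^ j).sum := by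
  obtain ⟨μ, hμ, htrace⟩ := exists_trace_pow_eq_sum_pow
    (Nat.cast_ne_zero.2 (Monoid.exponent_ne_zero_of_finite (G := G))) (f := ρ g)
    (by rw [← map_pow, Monoid.pow_exponent_eq_one, map_one])
  have : NeZero (Monoid.exponent G) := ⟨Monoid.exponent_ne_zero_of_finite⟩
  choose d _ hd using fun i => hω.eq_pow_of_pow_eq_one (hμ i)
  refine ⟨Finset.univ.val.map d, fun j => ?_⟩
  rw [Multiset.map_map, Representation.character, map_pow, htrace]
  simp only [Function.comp_def, hd, Finset.sum_map_val]

theorem exists_charSum_multisetPow_eq_sum (ρ : Representation ℂ G V) (X : Multiset G) :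
    ∃ e : Multiset ℕ, ∀ j : ℕ,
      charSum ρ.character (multisetPow X j) = (e.map fun i => (ω ^ i) ^ j).sum := by
  induction X using Multiset.induction_on with
  | empty => exact ⟨0, fun _ => by simp [charSum, multisetPow]⟩
  | cons g X ih =>
    obtain ⟨e, he⟩ := ih
    obtain ⟨d, hd⟩ := exists_character_pow_eq_sum hω ρ g
    refine ⟨d + e, fun j => ?_⟩
    rw [Multiset.map_add, Multiset.sum_add, ← hd, ← he]
    simp [charSum, multisetPow]

end

theorem multisetPow_one (X : Multiset G) : multisetPow X 1 = X := by
  simp [multisetPow]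

theorem multisetPow_exponent_sub_one [Finite G] (X : Multiset G) :
    multisetPow X (Monoid.exponent G - 1) = X.map (·⁻¹) := by
  refine Multiset.map_congr rfl fun g _ => eq_inv_of_mul_eq_one_left ?_
  rw [pow_sub_one_mul Monoid.exponent_ne_zero_of_finite, Monoid.pow_exponent_eq_one]

theorem charSum_map_inv [Finite G] {V : Type*} [AddCommGroup V] [Module ℂ V]
    [FiniteDimensional ℂ V] (ρ : Representation ℂ G V) (X : Multiset G) :
    charSum ρ.character (X.map (·⁻¹)) = conj (charSum ρ.character X) := by
  have hm : Monoid.exponent G ≠ 0 := Monoid.exponent_ne_zero_of_finite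
  have hω := Complex.isPrimitiveRoot_exp _ hm
  obtain ⟨e, he⟩ := exists_charSum_multisetPow_eq_sum hω ρ X
  have hconj {z : ℂ} (hz : z ^ Monoid.exponent G = 1) : z ^ (Monoid.exponent G - 1) = conj z := by
    rw [← Complex.inv_eq_conj (Complex.norm_eq_one_of_pow_eq_one hz hm)]
    exact eq_inv_of_mul_eq_one_left (by rw [pow_sub_one_mul hm, hz])
  have h1 := he 1
  rw [multisetPow_one] at h1
  rw [← multisetPow_exponent_sub_one, he, h1, map_multiset_sum, Multiset.map_map]
  refine congrArg _ (Multiset.map_congr rfl fun i _ => ?_)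
  rw [hconj (by rw [pow_right_comm, hω.pow_eq_one, one_pow]), Function.comp_apply, pow_one]

section Irr

variable {χ : G → ℂ}

theorem Irr.exists_div_apply_one_eq_smul (hχ : χ ∈ Irr G) :
    ∃ c : ℚ, c ≠ 0 ∧ ∀ z : ℂ, z / χ 1 = c • z := by
  obtain ⟨n, ρ, hρ, rfl⟩ := hχ
  have hone : ρ.character 1 = n := by rw [Representation.char_one, Module.finrank_fin_fun]
  have hn : n ≠ 0 := Nat.cast_ne_zero.1 (hone ▸ character_one_ne_zero ρ)
  exact ⟨(n : ℚ)⁻¹, inv_ne_zero (Nat.cast_ne_zero.2 hn), fun z => by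
    rw [hone, Algebra.smul_def, map_inv₀, map_natCast, div_eq_inv_mul]⟩

variable [Finite G]

theorem eq_of_forall_mem_Irr_charSum_eq {X Y : Multiset G} (hX : ConjInvariant X)
    (hY : ConjInvariant Y) (h : ∀ χ ∈ Irr G, charSum χ X = charSum χ Y) : X = Y := by
  have : NeZero (Nat.card G : ℂ) := ⟨Nat.cast_ne_zero.2 Nat.card_pos.ne'⟩
  refine groupAlgebraSum_injective ℂ (sub_eq_zero.1 ?_)
  refine eq_zero_of_forall_isIrreducible_asAlgebraHom_eq_zero fun n ρ hρ => ?_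
  rw [map_sub, asAlgebraHom_groupAlgebraSum_eq_smul_one ρ hX,
    asAlgebraHom_groupAlgebraSum_eq_smul_one ρ hY, h _ ⟨n, ρ, hρ, rfl⟩, sub_self]

theorem mem_spectrum_groupAlgebraSum_iff {X : Multiset G} (hX : ConjInvariant X) {z : ℂ} :
    z ∈ spectrum ℂ (groupAlgebraSum ℂ X) ↔ ∃ χ ∈ Irr G, z = charSum χ X / χ 1 := by
  rw [mem_spectrum_iff_exists_isIrreducible ((groupAlgebraSum_mem_center_iff ℂ).2 hX)]
  have hscalar {n : ℕ} (ρ : Representation ℂ G (Fin n → ℂ)) (hρ : ρ.IsIrreducible) :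
      ρ.asAlgebraHom (groupAlgebraSum ℂ X) = z • 1 ↔
        z = charSum ρ.character X / ρ.character 1 := by
    have := nontrivial_of_isIrreducible ρ
    rw [asAlgebraHom_groupAlgebraSum_eq_smul_one ρ hX, eq_comm]
    exact (smul_left_injective ℂ (one_ne_zero (α := Module.End ℂ (Fin n → ℂ)))).eq_iff
  constructor
  · rintro ⟨n, ρ, hρ, h⟩
    exact ⟨_, ⟨n, ρ, hρ, rfl⟩, (hscalar ρ hρ).1 h⟩
  · rintro ⟨_, ⟨n, ρ, hρ, rfl⟩, h⟩
    exact ⟨n, ρ, hρ, (hscalar ρ hρ).2 h⟩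

theorem charSum_mulInvMultiset {S : Finset G} (hS : ConjugateClosed S) (hχ : χ ∈ Irr G) :
    charSum χ (mulInvMultiset S) = (‖charSum χ S.val‖ : ℂ) ^ 2 / χ 1 := by
  obtain ⟨n, ρ, hρ, rfl⟩ := hχ
  rw [← trace_asAlgebraHom_groupAlgebraSum, groupAlgebraSum_mulInvMultiset, map_mul,
    asAlgebraHom_groupAlgebraSum_eq_smul_one ρ hS.conjInvariant,
    asAlgebraHom_groupAlgebraSum_eq_smul_one ρ hS.conjInvariant.map_inv, charSum_map_inv,
    smul_mul_smul_comm, mul_one, map_smul, LinearMap.trace_one, ← Representation.char_one ρ,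
    div_mul_div_comm, Complex.mul_conj', smul_eq_mul, div_mul_eq_mul_div,
    mul_div_mul_right _ _ (character_one_ne_zero ρ)]

end Irr

end Characters

section Cyclotomic

open IntermediateField

section

variable {F L : Type*} [Field F] [Field L] [Algebra F L]

theorem adjoin_eq_adjoin_of_eq_smul {ι : Type*} {s : Set ι} {f g : ι → L}
    (h : ∀ i ∈ s, ∃ c : F, c ≠ 0 ∧ g i = c • f i) :
    adjoin F {z | ∃ i ∈ s, z = g i} = adjoin F {z | ∃ i ∈ s, z = f i} := by
  refine le_antisymm (adjoin_le_iff.2 ?_) (adjoin_le_iff.2 ?_) <;> rintro _ ⟨i, hi, rfl⟩ <;>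
    obtain ⟨c, hc, hgf⟩ := h i hi
  · have hmem : f i ∈ adjoin F {z | ∃ i ∈ s, z = f i} := subset_adjoin F _ ⟨i, hi, rfl⟩
    exact hgf ▸ smul_mem _ hmem
  · have hmem : g i ∈ adjoin F {z | ∃ i ∈ s, z = g i} := subset_adjoin F _ ⟨i, hi, rfl⟩
    exact (eq_inv_smul_iff₀ hc).2 hgf.symm ▸ smul_mem _ hmem

theorem adjoin_sq_eq_sq_eq_adjoin {ι : Type*} (s : Set ι) (f : ι → L) :
    adjoin F {z | ∃ i ∈ s, z ^ 2 = f i ^ 2} = adjoin F {z | ∃ i ∈ s, z = f i} := by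
  refine le_antisymm (adjoin_le_iff.2 ?_) (adjoin.mono F _ _ ?_)
  · rintro z ⟨i, hi, hz⟩
    have hmem : f i ∈ adjoin F {z | ∃ i ∈ s, z = f i} := subset_adjoin F _ ⟨i, hi, rfl⟩
    rcases sq_eq_sq_iff_eq_or_eq_neg.1 hz with rfl | rfl
    · exact hmem
    · exact neg_mem hmem
  · rintro _ ⟨i, hi, rfl⟩
    exact ⟨i, hi, rfl⟩

end

section

variable {m : ℕ} [NeZero m] {ω : ℂ} (hω : IsPrimitiveRoot ω m)

include hω

theorem isCyclotomicExtension_adjoin : IsCyclotomicExtension {m} ℚ ℚ⟮ω⟯ := by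
  change IsCyclotomicExtension {m} ℚ ℚ⟮ω⟯.toSubalgebra
  rw [adjoin_simple_toSubalgebra_of_isAlgebraic
    (hω.isIntegral (NeZero.pos m)).tower_top.isAlgebraic]
  exact hω.adjoin_isCyclotomicExtension ℚ

theorem cyclotomicEta_bijective : Function.Bijective (cyclotomicEta hω) := by
  have := isCyclotomicExtension_adjoin hω
  have := IsCyclotomicExtension.finiteDimensional {m} ℚ ℚ⟮ω⟯
  have hirr := Polynomial.cyclotomic.irreducible_rat (NeZero.pos m)
  exact (Nat.bijective_iff_injective_and_card _).2
    ⟨(isPrimitiveRoot_gen hω).autToPow_injective ℚ,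
      Nat.card_congr (IsCyclotomicExtension.autEquivPow ℚ⟮ω⟯ hirr).toEquiv⟩

theorem finrank_fixedSubfield_mul_card (T : Subgroup (ZMod m)ˣ) :
    Module.finrank ℚ (fixedSubfield hω T) * Nat.card T = m.totient := by
  have := isCyclotomicExtension_adjoin hω
  have := IsCyclotomicExtension.finiteDimensional {m} ℚ ℚ⟮ω⟯
  have hcard : Nat.card (T.comap (cyclotomicEta hω)) = Nat.card T :=
    Nat.card_congr ((Equiv.ofBijective _ (cyclotomicEta_bijective hω)).subtypeEquiv
      fun _ => Iff.rfl)
  have hlift : Module.finrank ℚ (fixedSubfield hω T) =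
      Module.finrank ℚ (fixedField (T.comap (cyclotomicEta hω))) :=
    (liftAlgEquiv _).toLinearEquiv.finrank_eq.symm
  rw [hlift, ← hcard, ← finrank_fixedField_eq_card, Module.finrank_mul_finrank,
    IsCyclotomicExtension.finrank ℚ⟮ω⟯ (Polynomial.cyclotomic.irreducible_rat (NeZero.pos m))]

end

variable {G : Type*} [Group G] [Finite G] {ω : ℂ} (hω : IsPrimitiveRoot ω (Monoid.exponent G))

include hω

theorem exists_coe_eq_charSum {χ : G → ℂ} (hχ : χ ∈ Irr G) (X : Multiset G) :
    ∃ x : ℚ⟮ω⟯, (x : ℂ) = charSum χ X ∧ ∀ σ : ℚ⟮ω⟯ ≃ₐ[ℚ] ℚ⟮ω⟯,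
      (σ x : ℂ) =
        charSum χ (multisetPow X (cyclotomicEta hω σ : ZMod (Monoid.exponent G)).val) := by
  obtain ⟨n, ρ, -, rfl⟩ := hχ
  obtain ⟨e, he⟩ := exists_charSum_multisetPow_eq_sum hω ρ X
  have hcoe (j : ℕ) : ((e.map fun i => (AdjoinSimple.gen ℚ ω ^ i) ^ j).sum : ℂ) =
      charSum ρ.character (multisetPow X j) := by
    rw [he]
    refine (map_multiset_sum (algebraMap ℚ⟮ω⟯ ℂ) _).trans ?_
    simp only [Multiset.map_map, Function.comp_def, map_pow, AdjoinSimple.algebraMap_gen]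
  refine ⟨(e.map fun i => (AdjoinSimple.gen ℚ ω ^ i) ^ 1).sum, ?_, fun σ => ?_⟩
  · rw [hcoe, multisetPow_one]
  · have hσ : σ (AdjoinSimple.gen ℚ ω) = AdjoinSimple.gen ℚ ω ^
        (cyclotomicEta hω σ : ZMod (Monoid.exponent G)).val :=
      ((isPrimitiveRoot_gen hω).autToPow_spec ℚ σ).symm
    rw [← hcoe, map_multiset_sum, Multiset.map_map]
    simp only [Function.comp_def, pow_one, map_pow, hσ, pow_right_comm]

theorem comap_cyclotomicEta_powStabilizer {X : Multiset G} (hX : ConjInvariant X) :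
    (powStabilizer X).comap (cyclotomicEta hω) =
      (adjoin ℚ {x : ℚ⟮ω⟯ | ∃ χ ∈ Irr G, (x : ℂ) = charSum χ X}).fixingSubgroup := by
  ext σ
  rw [IntermediateField.mem_fixingSubgroup_iff]
  refine Iff.trans ?_ (forall_mem_adjoin_smul_eq_self_iff ℚ σ).symm
  constructor
  · rintro (hσ : multisetPow X _ = X) x ⟨χ, hχ, hx⟩
    obtain ⟨y, hy, hσy⟩ := exists_coe_eq_charSum hω hχ X
    obtain rfl : x = y := Subtype.ext (hx.trans hy.symm)
    exact Subtype.ext (by rw [AlgEquiv.smul_def, hσy, hσ, hy])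
  · refine fun hσ => eq_of_forall_mem_Irr_charSum_eq (hX.multisetPow _) hX fun χ hχ => ?_
    obtain ⟨x, hx, hσx⟩ := exists_coe_eq_charSum hω hχ X
    rw [← hσx, ← hx]
    exact congrArg _ (hσ x ⟨χ, hχ, hx⟩)

theorem fixedSubfield_powStabilizer {X : Multiset G} (hX : ConjInvariant X) :
    fixedSubfield hω (powStabilizer X) =
      adjoin ℚ {z : ℂ | ∃ χ ∈ Irr G, z = charSum χ X} := by
  have := isCyclotomicExtension_adjoin hω
  have := IsCyclotomicExtension.finiteDimensional {Monoid.exponent G} ℚ ℚ⟮ω⟯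
  have := IsCyclotomicExtension.isGalois {Monoid.exponent G} ℚ ℚ⟮ω⟯
  have himage : {z : ℂ | ∃ χ ∈ Irr G, z = charSum χ X} =
      Subtype.val '' {x : ℚ⟮ω⟯ | ∃ χ ∈ Irr G, (x : ℂ) = charSum χ X} := by
    ext z
    constructor
    · rintro ⟨χ, hχ, rfl⟩
      obtain ⟨x, hx, -⟩ := exists_coe_eq_charSum hω hχ X
      exact ⟨x, ⟨χ, hχ, hx⟩, hx⟩
    · rintro ⟨x, hx, rfl⟩
      exact hx
  have hfixed := IsGalois.fixedField_fixingSubgroup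
    (adjoin ℚ {x : ℚ⟮ω⟯ | ∃ χ ∈ Irr G, (x : ℂ) = charSum χ X})
  rw [← comap_cyclotomicEta_powStabilizer hω hX] at hfixed
  rw [himage, ← lift_adjoin]
  exact congrArg lift hfixed

theorem fixedSubfield_powStabilizer_mulInvMultiset {S : Finset G} (hS : ConjugateClosed S) :
    fixedSubfield hω (powStabilizer (mulInvMultiset S)) =
      adjoin ℚ {z : ℂ | ∃ χ ∈ Irr G, z = (‖charSum χ S.val‖ : ℂ) ^ 2} := by
  rw [fixedSubfield_powStabilizer hω hS.conjInvariant_mulInvMultiset]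
  refine adjoin_eq_adjoin_of_eq_smul fun χ hχ => ?_
  obtain ⟨c, hc, hdiv⟩ := Irr.exists_div_apply_one_eq_smul hχ
  exact ⟨c, hc, by rw [charSum_mulInvMultiset hS hχ, hdiv]⟩

end Cyclotomic

section Kummer

open IntermediateField

theorem card_le_card_of_injective_monoidHom_units {A B K : Type*} [Monoid A] [Finite A] [Field K]
    {Φ : B → A →* Kˣ} (hΦ : Function.Injective Φ) : Nat.card B ≤ Nat.card A := by
  have hcoe : Function.Injective fun f : A →* Kˣ => (Units.coeHom K).comp f :=
    fun _ _ => (MonoidHom.cancel_left Units.val_injective).1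
  have hli := (linearIndependent_monoidHom A K).comp _ (hcoe.comp hΦ)
  have := Fintype.ofFinite A
  have := hli.finite_of_isNoetherian
  have := Fintype.ofFinite B
  simpa [Nat.card_eq_fintype_card] using hli.fintype_card_le_finrank

theorem card_eq_card_of_forall_apply_eq_one {A K : Type*} [Group A] [Finite A] [Field K]
    (H : Subgroup (A →* Kˣ)) (hH : ∀ a, (∀ f ∈ H, f a = 1) → a = 1) :
    Nat.card A = Nat.card H := by
  let evalHom : A →* H →* Kˣ := (MonoidHom.compHom' H.subtype).comp MonoidHom.eval
  have heval : Function.Injective evalHom := (injective_iff_map_eq_one _).2 fun a ha =>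
    hH a fun f hf => DFunLike.congr_fun ha ⟨f, hf⟩
  exact le_antisymm (card_le_card_of_injective_monoidHom_units heval)
    (card_le_card_of_injective_monoidHom_units H.subtype_injective)

section

variable (n : ℕ) (F L : Type*) [Field F] [Field L] [Algebra F L]

/-- The group of nonzero `n`-th roots in `L` of elements of `F`. -/
def kummerRadicals : Subgroup Lˣ :=
  (Units.map (algebraMap F L : F →* L)).range.comap (powMonoidHom n)

theorem units_map_algebraMap_injective :
    Function.Injective (Units.map (algebraMap F L : F →* L)) :=
  Units.map_injective (algebraMap F L).injective

/-- The class of `x ^ n` in `Fˣ / (Fˣ)ⁿ`, for a radical `x`. -/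
noncomputable def powerClass : kummerRadicals n F L →* Fˣ ⧸ (powMonoidHom n : Fˣ →* Fˣ).range :=
  (QuotientGroup.mk' _).comp <|
    (MonoidHom.ofInjective (units_map_algebraMap_injective F L)).symm.toMonoidHom.comp <|
      (powMonoidHom n).subgroupComap (Units.map (algebraMap F L : F →* L)).range

end

variable {n : ℕ} {F L : Type*} [Field F] [Field L] [Algebra F L]

theorem powerClass_eq_mk {x : kummerRadicals n F L} {u : Fˣ}
    (h : ((x : Lˣ) : L) ^ n = algebraMap F L u) : powerClass n F L x = QuotientGroup.mk u := by
  exact congrArg QuotientGroup.mk <|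
    (MulEquiv.symm_apply_eq (MonoidHom.ofInjective (units_map_algebraMap_injective F L))).2
      (Subtype.ext (Units.ext h))

theorem exists_kummerRadicals_of_pow_eq [NeZero n] {z : L} {u : Fˣ} (h : z ^ n = algebraMap F L u) :
    ∃ x : kummerRadicals n F L, ((x : Lˣ) : L) = z := by
  have hz : z ≠ 0 := fun hz => u.ne_zero <| (map_eq_zero (algebraMap F L)).1 <| by
    rw [← h, hz, zero_pow (NeZero.ne n)]
  exact ⟨⟨Units.mk0 z hz, u, Units.ext h.symm⟩, rfl⟩

section

variable [NeZero n] [HasEnoughRootsOfUnity F n]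

theorem mem_range_algebraMap_of_pow_eq_one {z : L} (hz : z ^ n = 1) :
    z ∈ (algebraMap F L).range := by
  obtain ⟨ζ, hζ⟩ := HasEnoughRootsOfUnity.exists_primitiveRoot F n
  obtain ⟨i, -, rfl⟩ :=
    (hζ.map_of_injective (algebraMap F L).injective).eq_pow_of_pow_eq_one hz
  exact ⟨ζ ^ i, map_pow _ _ _⟩

theorem powerClass_eq_one_iff {x : kummerRadicals n F L} :
    powerClass n F L x = 1 ↔ ((x : Lˣ) : L) ∈ (algebraMap F L).range := by
  constructor
  · obtain ⟨x, u, hu⟩ := x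
    have hux : (x : L) ^ n = algebraMap F L u := (congrArg Units.val hu).symm
    rw [powerClass_eq_mk hux, QuotientGroup.eq_one_iff]
    rintro ⟨v, rfl⟩
    have hv : algebraMap F L v ≠ 0 := (map_ne_zero _).2 v.ne_zero
    have hroot : ((x : L) / algebraMap F L v) ^ n = 1 := by
      rw [div_pow, hux, powMonoidHom_apply, Units.val_pow_eq_pow_val, map_pow,
        div_self (pow_ne_zero n hv)]
    simpa [hv] using mul_mem (mem_range_algebraMap_of_pow_eq_one hroot) ⟨(v : F), rfl⟩
  · rintro ⟨a, ha⟩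
    have ha0 : a ≠ 0 := fun h => (x : Lˣ).ne_zero (by rw [← ha, h, map_zero])
    rw [powerClass_eq_mk (u := Units.mk0 a ha0 ^ n) (by rw [← ha]; simp), QuotientGroup.eq_one_iff]
    exact ⟨_, rfl⟩

theorem apply_apply_div_of_mem_kummerRadicals {x : Lˣ} (hx : x ∈ kummerRadicals n F L)
    (σ τ : Gal(L/F)) : σ (τ (x : L) / x) = τ (x : L) / x := by
  obtain ⟨u, hu⟩ := hx
  have hux : (x : L) ^ n = algebraMap F L u := (congrArg Units.val hu).symm
  have hroot : (τ (x : L) / x) ^ n = 1 := by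
    rw [div_pow, ← map_pow, hux, AlgEquiv.commutes,
      div_self ((map_ne_zero (algebraMap F L)).2 u.ne_zero)]
  obtain ⟨a, ha⟩ := mem_range_algebraMap_of_pow_eq_one (F := F) hroot
  rw [← ha, AlgEquiv.commutes]

theorem units_map_mul_div_of_mem_kummerRadicals {x : Lˣ} (hx : x ∈ kummerRadicals n F L)
    (σ τ : Gal(L/F)) : Units.map ((σ * τ : Gal(L/F)) : L →* L) x / x =
      Units.map (σ : L →* L) x / x * (Units.map (τ : L →* L) x / x) := by
  have hστ : Units.map (σ : L →* L) (Units.map (τ : L →* L) x / x) =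
      Units.map (τ : L →* L) x / x :=
    Units.ext (by simpa using apply_apply_div_of_mem_kummerRadicals hx σ τ)
  rw [map_div, div_eq_iff_eq_mul'] at hστ
  rw [← mul_div_right_comm, ← hστ]
  rfl

/-- The Kummer pairing `(x, σ) ↦ σ x / x` between the radicals and the Galois group. -/
noncomputable def kummerCharacter : kummerRadicals n F L →* Gal(L/F) →* Lˣ :=
  MonoidHom.mk'
    (fun x => MonoidHom.mk' (fun σ => Units.map (σ : L →* L) x / x)
      (units_map_mul_div_of_mem_kummerRadicals x.2))
    fun x y => MonoidHom.ext fun σ => by simp [mul_div_mul_comm]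

theorem kummerCharacter_apply (x : kummerRadicals n F L) (σ : Gal(L/F)) :
    kummerCharacter x σ = Units.map (σ : L →* L) x / x := rfl

theorem kummerCharacter_apply_eq_one_iff {x : kummerRadicals n F L} {σ : Gal(L/F)} :
    kummerCharacter x σ = 1 ↔ σ ((x : Lˣ) : L) = (x : Lˣ) := by
  rw [kummerCharacter_apply, div_eq_one, ← Units.val_inj]
  rfl

theorem ker_kummerCharacter [FiniteDimensional F L] [IsGalois F L] :
    (kummerCharacter : kummerRadicals n F L →* _).ker = (powerClass n F L).ker := by
  ext x
  rw [MonoidHom.mem_ker, MonoidHom.mem_ker, powerClass_eq_one_iff, MonoidHom.ext_iff]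
  simp only [MonoidHom.one_apply, kummerCharacter_apply_eq_one_iff]
  exact (IsGalois.mem_range_algebraMap_iff_fixed _).symm

theorem finrank_eq_card_closure_powerClass [FiniteDimensional F L] [IsGalois F L]
    {R : Set (kummerRadicals n F L)} (hR : adjoin F {z : L | ∃ x ∈ R, z = (x : Lˣ)} = ⊤) :
    Module.finrank F L = Nat.card (Subgroup.closure (powerClass n F L '' R)) := by
  have hsep (σ : Gal(L/F)) (hσ : ∀ f ∈ (Subgroup.closure R).map kummerCharacter, f σ = 1) :
      σ = 1 := by
    have hfix : ∀ y ∈ adjoin F {z : L | ∃ x ∈ R, z = (x : Lˣ)}, σ • y = y := by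
      rw [forall_mem_adjoin_smul_eq_self_iff]
      rintro _ ⟨x, hx, rfl⟩
      exact kummerCharacter_apply_eq_one_iff.1
        (hσ _ (Subgroup.mem_map_of_mem _ (Subgroup.subset_closure hx)))
    exact AlgEquiv.ext fun y => hfix y (hR ▸ mem_top)
  rw [← MonoidHom.map_closure, ← IsGalois.card_aut_eq_finrank,
    card_eq_card_of_forall_apply_eq_one _ hsep, ← Subgroup.relIndex_ker, ← Subgroup.relIndex_ker,
    ker_kummerCharacter]

theorem finrank_eq_card_closure_of_adjoin_eq_top [FiniteDimensional F L] [IsGalois F L]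
    {Z : Set L} (hZ : adjoin F Z = ⊤) (hpow : ∀ z ∈ Z, z ^ n ∈ (algebraMap F L).range) :
    Module.finrank F L = Nat.card (Subgroup.closure {c : Fˣ ⧸ (powMonoidHom n : Fˣ →* Fˣ).range |
      ∃ u : Fˣ, (∃ z ∈ Z, z ^ n = algebraMap F L u) ∧ c = QuotientGroup.mk u}) := by
  let R : Set (kummerRadicals n F L) := {x | ((x : Lˣ) : L) ∈ Z}
  have hR : adjoin F {z : L | ∃ x ∈ R, z = (x : Lˣ)} = ⊤ := by
    rw [← top_le_iff, ← hZ, adjoin_le_iff]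
    intro z hz
    rcases eq_or_ne z 0 with rfl | hz0
    · exact zero_mem _
    obtain ⟨a, ha⟩ := hpow z hz
    have ha0 : a ≠ 0 := (map_ne_zero (algebraMap F L)).1 (ha ▸ pow_ne_zero n hz0)
    obtain ⟨x, rfl⟩ := exists_kummerRadicals_of_pow_eq (u := Units.mk0 a ha0) ha.symm
    exact subset_adjoin _ _ ⟨x, hz, rfl⟩
  have himage : powerClass n F L '' R =
      {c | ∃ u : Fˣ, (∃ z ∈ Z, z ^ n = algebraMap F L u) ∧ c = QuotientGroup.mk u} := by
    ext c
    constructor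
    · rintro ⟨x, hx, rfl⟩
      obtain ⟨u, hu⟩ := x.2
      have hxu : ((x : Lˣ) : L) ^ n = algebraMap F L u := (congrArg Units.val hu).symm
      exact ⟨u, ⟨_, hx, hxu⟩, powerClass_eq_mk hxu⟩
    · rintro ⟨u, ⟨z, hz, hu⟩, rfl⟩
      obtain ⟨x, rfl⟩ := exists_kummerRadicals_of_pow_eq hu
      exact ⟨x, hz, powerClass_eq_mk hu⟩
  rw [finrank_eq_card_closure_powerClass hR, himage]

end

theorem finrank_adjoin_eq_card_squareClassSubgroup {K : IntermediateField ℚ ℂ} {ι : Type*}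
    {s : Set ι} {f : ι → ℂ} (hf : ∀ i ∈ s, f i ^ 2 ∈ K)
    [FiniteDimensional K (adjoin K {z | ∃ i ∈ s, z = f i})]
    [IsGalois K (adjoin K {z | ∃ i ∈ s, z = f i})] :
    Module.finrank K (adjoin K {z | ∃ i ∈ s, z = f i}) =
      Nat.card (squareClassSubgroup K {z | ∃ i ∈ s, z = f i ^ 2}) := by
  have : HasEnoughRootsOfUnity K 2 :=
    ⟨⟨-1, IsPrimitiveRoot.neg_one 0 two_ne_zero.symm⟩, inferInstance⟩
  let Z : Set (adjoin K {z | ∃ i ∈ s, z = f i}) := {z | ∃ i ∈ s, (z : ℂ) = f i}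
  have hmem {i} (hi : i ∈ s) : f i ∈ adjoin K {z | ∃ i ∈ s, z = f i} :=
    subset_adjoin _ _ ⟨i, hi, rfl⟩
  have hZ : adjoin K Z = ⊤ := by
    rw [← lift_inj, lift_adjoin, lift_top]
    refine congrArg (adjoin K) (Set.ext fun z => ⟨?_, ?_⟩)
    · rintro ⟨z, hz, rfl⟩
      exact hz
    · rintro ⟨i, hi, rfl⟩
      exact ⟨⟨_, hmem hi⟩, ⟨i, hi, rfl⟩, rfl⟩
  have hpow : ∀ z ∈ Z, z ^ 2 ∈ (algebraMap K (adjoin K {z | ∃ i ∈ s, z = f i})).range := by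
    rintro ⟨z, _⟩ ⟨i, hi, rfl⟩
    exact ⟨⟨_, hf i hi⟩, rfl⟩
  have hsq (u : Kˣ) : (∃ z ∈ Z, z ^ 2 = algebraMap K _ (u : K)) ↔
      ∃ i ∈ s, ((u : K) : ℂ) = f i ^ 2 := by
    constructor
    · rintro ⟨⟨z, _⟩, ⟨i, hi, rfl⟩, hu⟩
      exact ⟨i, hi, (congrArg Subtype.val hu).symm⟩
    · rintro ⟨i, hi, hu⟩
      exact ⟨⟨_, hmem hi⟩, ⟨i, hi, rfl⟩, Subtype.ext hu.symm⟩
  rw [finrank_eq_card_closure_of_adjoin_eq_top hZ hpow]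
  simp only [hsq, squareClassSubgroup, Set.mem_ofPred_eq]

theorem finrank_eq_finrank_mul_card_squareClassSubgroup {K E : IntermediateField ℚ ℂ}
    {ι : Type*} {s : Set ι} {f : ι → ℂ} (hf : ∀ i ∈ s, f i ^ 2 ∈ K)
    (hE : E = (adjoin K {z | ∃ i ∈ s, z = f i}).restrictScalars ℚ)
    [FiniteDimensional ℚ E] [IsGalois ℚ E] :
    Module.finrank ℚ E =
      Module.finrank ℚ K * Nat.card (squareClassSubgroup K {z | ∃ i ∈ s, z = f i ^ 2}) := by
  subst hE
  have : FiniteDimensional ℚ (adjoin K {z | ∃ i ∈ s, z = f i}) :=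
    ‹FiniteDimensional ℚ ((adjoin K {z | ∃ i ∈ s, z = f i}).restrictScalars ℚ)›
  have : IsGalois ℚ (adjoin K {z | ∃ i ∈ s, z = f i}) :=
    ‹IsGalois ℚ ((adjoin K {z | ∃ i ∈ s, z = f i}).restrictScalars ℚ)›
  have : FiniteDimensional K (adjoin K {z | ∃ i ∈ s, z = f i}) := .right ℚ K _
  have : IsGalois K (adjoin K {z | ∃ i ∈ s, z = f i}) := .tower_top_of_isGalois ℚ K _
  rw [← finrank_adjoin_eq_card_squareClassSubgroup hf]
  exact (Module.finrank_mul_finrank ℚ K (adjoin K {z | ∃ i ∈ s, z = f i})).symm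

end Kummer

section BiCayley

open IntermediateField

variable {G : Type*} [Group G] {S : Finset G}

theorem BCay_adj_inl_inr {g h : G} : (BCay S).Adj (.inl g) (.inr h) ↔ h * g⁻¹ ∈ S := by
  constructor
  · rintro (⟨x, s, hs, hx, hy⟩ | ⟨x, s, _, hx, _⟩)
    · rw [Sum.inl.inj hx, Sum.inr.inj hy, mul_inv_cancel_right]
      exact hs
    · exact absurd hx Sum.inr_ne_inl
  · exact fun h => .inl ⟨g, _, h, rfl, by rw [inv_mul_cancel_right]⟩

theorem not_BCay_adj_inl_inl {g h : G} : ¬(BCay S).Adj (.inl g) (.inl h) := by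
  simp [BCay]

theorem not_BCay_adj_inr_inr {g h : G} : ¬(BCay S).Adj (.inr g) (.inr h) := by
  simp [BCay]

variable [Fintype G]

theorem leftMulMatrix_groupAlgebraSum_apply [DecidableEq G] (k : Type*) [CommRing k]
    (X : Multiset G) (g h : G) :
    Algebra.leftMulMatrix (MonoidAlgebra.basis G k) (groupAlgebraSum k X) g h =
      X.count (g * h⁻¹) := by
  rw [Algebra.leftMulMatrix_eq_repr_mul, ← coeff_groupAlgebraSum k]
  change (groupAlgebraSum k X * MonoidAlgebra.single h 1).coeff g = _
  rw [MonoidAlgebra.coeff_mul_single_apply, mul_one]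

open Classical in
theorem adjMatrix_BCay (k : Type*) [CommRing k] (S : Finset G) :
    (BCay S).adjMatrix k = Matrix.fromBlocks 0
      (Algebra.leftMulMatrix (MonoidAlgebra.basis G k) (groupAlgebraSum k (S.val.map (·⁻¹))))
      (Algebra.leftMulMatrix (MonoidAlgebra.basis G k) (groupAlgebraSum k S.val)) 0 := by
  have hinv (g h : G) : (S.val.map (·⁻¹)).count (g * h⁻¹) = S.val.count (h * g⁻¹) := by
    rw [← Multiset.count_map_eq_count' _ _ inv_injective (h * g⁻¹), mul_inv_rev, inv_inv]
  have hcount (g : G) : (S.val.count g : k) = if g ∈ S then 1 else 0 := by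
    simp only [Multiset.count_eq_of_nodup S.nodup, Finset.mem_val, Nat.cast_ite, Nat.cast_one,
      Nat.cast_zero]
  ext (g | g) (h | h)
  · simp [not_BCay_adj_inl_inl]
  · simp [BCay_adj_inl_inr, leftMulMatrix_groupAlgebraSum_apply, hinv, hcount]
  · simp [(BCay S).adj_comm (.inr g), BCay_adj_inl_inr, leftMulMatrix_groupAlgebraSum_apply,
      hcount]
  · simp [not_BCay_adj_inr_inr]

open Classical in
theorem isRoot_charpoly_adjMatrix_BCay_iff (hS : ConjugateClosed S) {z : ℂ} :
    ((BCay S).adjMatrix ℂ).charpoly.IsRoot z ↔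
      ∃ χ ∈ Irr G, z ^ 2 = ((‖charSum χ S.val‖ : ℂ) / χ 1) ^ 2 := by
  rw [adjMatrix_BCay, isRoot_charpoly_fromBlocks_zero_zero_iff, ← map_mul,
    isRoot_charpoly_leftMulMatrix_iff, ← groupAlgebraSum_mulInvMultiset,
    mem_spectrum_groupAlgebraSum_iff hS.conjInvariant_mulInvMultiset]
  refine exists_congr fun χ => and_congr_right fun hχ => ?_
  rw [charSum_mulInvMultiset hS hχ, div_div, ← sq, div_pow]

theorem graphSplittingField_BCay (hS : ConjugateClosed S) :
    graphSplittingField (BCay S) =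
      adjoin ℚ {z : ℂ | ∃ χ ∈ Irr G, z = ‖charSum χ S.val‖} := by
  have hroots : graphSplittingField (BCay S) =
      adjoin ℚ {z : ℂ | ∃ χ ∈ Irr G, z ^ 2 = ((‖charSum χ S.val‖ : ℂ) / χ 1) ^ 2} := by
    classical
    simp only [← isRoot_charpoly_adjMatrix_BCay_iff hS, graphSplittingField]
    congr!
  rw [hroots, adjoin_sq_eq_sq_eq_adjoin]
  refine adjoin_eq_adjoin_of_eq_smul fun χ hχ => ?_
  obtain ⟨c, hc, hdiv⟩ := Irr.exists_div_apply_one_eq_smul hχ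
  exact ⟨c, hc, hdiv _⟩

end BiCayley

section SplittingField

open IntermediateField

variable {V : Type*} [Fintype V] (Γ : SimpleGraph V)

open Classical in
theorem isSplittingField_graphSplittingField :
    (Γ.adjMatrix ℚ).charpoly.IsSplittingField ℚ (graphSplittingField Γ) := by
  have hmap : (Γ.adjMatrix ℚ).charpoly.map (algebraMap ℚ ℂ) = (Γ.adjMatrix ℂ).charpoly := by
    rw [← Matrix.charpoly_map]
    congr 1
    ext i j
    simp [SimpleGraph.adjMatrix_apply, apply_ite (algebraMap ℚ ℂ)]
  have hroots : {z : ℂ | (Γ.adjMatrix ℂ).charpoly.IsRoot z} =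
      (Γ.adjMatrix ℚ).charpoly.rootSet ℂ := by
    ext z
    rw [Polynomial.mem_rootSet_of_ne (Matrix.charpoly_monic _).ne_zero, Set.mem_ofPred_eq,
      Polynomial.IsRoot.def, ← Polynomial.eval_map_algebraMap, hmap]
  rw [graphSplittingField, hroots]
  exact adjoin_rootSet_isSplittingField (IsAlgClosed.splits _)

theorem finiteDimensional_graphSplittingField : FiniteDimensional ℚ (graphSplittingField Γ) := by
  classical
  have := isSplittingField_graphSplittingField Γ
  exact Polynomial.IsSplittingField.finiteDimensional _ (Γ.adjMatrix ℚ).charpoly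

theorem isGalois_graphSplittingField : IsGalois ℚ (graphSplittingField Γ) := by
  classical
  have := isSplittingField_graphSplittingField Γ
  have := Normal.of_isSplittingField (F := ℚ) (E := graphSplittingField Γ)
    (Γ.adjMatrix ℚ).charpoly
  exact {}

end SplittingField

theorem mainTheorem5 {G : Type*} [Group G] [Fintype G] (S : Finset G) (hS : ConjugateClosed S)
    (ω : ℂ) (hω : IsPrimitiveRoot ω (Monoid.exponent G))
    (T : Subgroup (ZMod (Monoid.exponent G))ˣ) (hT : T = powStabilizer (mulInvMultiset S))
    (K : IntermediateField ℚ ℂ) (hK : K = fixedSubfield hω T) :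
    graphSplittingField (BCay S) =
        (IntermediateField.adjoin K
          {z : ℂ | ∃ χ ∈ Irr G, z = ((‖charSum χ S.val‖ : ℝ) : ℂ)}).restrictScalars ℚ ∧
      FiniteDimensional ℚ (graphSplittingField (BCay S)) ∧
      (∀ χ ∈ Irr G, ((‖charSum χ S.val‖ ^ 2 : ℝ) : ℂ) ∈ K) ∧
      (algebraicDegree (BCay S) : ℚ) =
        (Nat.totient (Monoid.exponent G) : ℚ) *
          (Nat.card (squareClassSubgroup K
            {z : ℂ | ∃ χ ∈ Irr G, z = ((‖charSum χ S.val‖ ^ 2 : ℝ) : ℂ)}) : ℚ) /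
          (Nat.card T : ℚ) := by
  simp only [Complex.ofReal_pow]
  have hKgen : K = IntermediateField.adjoin ℚ
      {z : ℂ | ∃ χ ∈ Irr G, z = (‖charSum χ S.val‖ : ℂ) ^ 2} := by
    rw [hK, hT, fixedSubfield_powStabilizer_mulInvMultiset hω hS]
  have hsq : ∀ χ ∈ Irr G, (‖charSum χ S.val‖ : ℂ) ^ 2 ∈ K := fun χ hχ => by
    rw [hKgen]
    exact IntermediateField.subset_adjoin ℚ _ ⟨χ, hχ, rfl⟩
  have hKle : K ≤ graphSplittingField (BCay S) := by
    rw [hKgen, graphSplittingField_BCay hS, IntermediateField.adjoin_le_iff]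
    rintro _ ⟨χ, hχ, rfl⟩
    refine pow_mem (IntermediateField.subset_adjoin ℚ _ ?_) 2
    exact ⟨χ, hχ, rfl⟩
  have hSF : graphSplittingField (BCay S) = (IntermediateField.adjoin K
      {z : ℂ | ∃ χ ∈ Irr G, z = (‖charSum χ S.val‖ : ℂ)}).restrictScalars ℚ := by
    refine Eq.trans ?_ (IntermediateField.restrictScalars_adjoin_eq_sup ℚ K _).symm
    rw [← graphSplittingField_BCay hS, sup_eq_right.2 hKle]
  have := isGalois_graphSplittingField (BCay S)
  have := finiteDimensional_graphSplittingField (BCay S)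
  refine ⟨hSF, this, hsq, ?_⟩
  rw [algebraicDegree, finrank_eq_finrank_mul_card_squareClassSubgroup hsq hSF,
    ← finrank_fixedSubfield_mul_card hω T, ← hK, eq_div_iff (Nat.cast_ne_zero.2 Nat.card_pos.ne')]
  push_cast
  ring
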